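/- Let $(W,S)$ be a right-angled Coxeter system with $S$ finite (all entries $m_{st}$, $s\neq t$, of the Coxeter matrix are $2$ or $\infty$), and let $\Delta$ be a building of type $(W,S)$, regarded as a chamber system with Weyl distance $\delta$; suppose that $\Delta$ is thick (every panel has at least three chambers) and semi-regular (for each $s\in S$, all $s$-panels have the same cardinality). An apartment of $\Delta$ is a subbuilding that is $\delta$-isometric to the thin building with set of chambers $W$ and Weyl distance $(x,y)\mapsto x^{-1}y$. A root of an apartment $A$ is a set $\alpha$ of chambers of $A$ consisting of all chambers of $A$ that are nearer to $x$ than to $y$ (in the gallery distance), for two adjacent chambers $x,y$ of $A$; its wall $\partial\alpha$ is the set of panels of $\Delta$ having chambers both in $\alpha$ and in $A\setminus\alpha$. For a chamber $c$ and $s\in S$, let $\mathcal P_{s,c}$ be the $s$-panel containing $c$, and let the $s$-wing $X_s(c)$ be the set of all chambers $x$ of $\Delta$ such that $c$ is the unique chamber of $\mathcal P_{s,c}$ closest to $x$. Let $\alpha$ be a root of an apartment $A$ of $\Delta$, let $s\in S$ and $c\in\alpha$ be such that $\mathcal P_{s,c}\in\partial\alpha$, and let $U_\alpha$ be the root wing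 group of $\alpha$, i.e. the group of all type-preserving automorphisms of $\Delta$ that fix every chamber of $X_s(c)$. Then $U_\alpha$ acts on the set of apartments of $\Delta$ containing $\alpha$, and this action is transitive: if $B$ and $B'$ are apartments of $\Delta$ containing $\alpha$, then there is some $g\in U_\alpha$ with $g(B)=B'$. (This holds for every choice of $s$ and $c$ as above.) -/

import Mathlib

open scoped Pointwise

/-- A Coxeter matrix is right-angled if all its off-diagonal entries are `2` or `∞`
(the value `∞` is encoded by `0`). -/
def CoxeterMatrix.IsRightAngled {S : Type*} (M : CoxeterMatrix S) : Prop :=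
  ∀ s t : S, s ≠ t → M s t = 2 ∨ M s t = 0

/-- A chamber system with set of chambers `C` and index set `S`: a graph on `C` whose edges are
coloured by `S` (`graph s` is the graph formed by the edges of colour `s`), such that the connected
components of each `graph s` (the `s`-panels) are complete graphs with at least two vertices. -/
structure ChamberSystem (S C : Type*) where
  /-- The graph of `s`-adjacency. -/
  graph : S → SimpleGraph C
  panel_complete : ∀ (s : S) (x y : C), (graph s).Reachable x y → x ≠ y → (graph s).Adj x y
  panel_nontrivial : ∀ (s : S) (x : C), ∃ y, (graph s).Adj x y

namespace ChamberSystem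

variable {S C : Type*} (D : ChamberSystem S C)

/-- The (set of chambers of the) `J`-residue containing `c`: the connected component of `c` in the
graph whose edges are the edges with colour in `J`. -/
def residue (J : Set S) (c : C) : Set C := {x | (⨆ s ∈ J, D.graph s).Reachable c x}

/-- The (set of chambers of the) `s`-panel containing `c`. -/
def panel (s : S) (c : C) : Set C := D.residue {s} c

theorem mem_panel_iff {s : S} {c x : C} : x ∈ D.panel s c ↔ x = c ∨ (D.graph s).Adj c x := by
  have h : (⨆ t ∈ ({s} : Set S), D.graph t) = D.graph s := by simp
  simp only [panel, residue, Set.mem_ofPred_eq, h]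
  constructor
  · intro hr
    by_cases hx : x = c
    · exact Or.inl hx
    · exact Or.inr (D.panel_complete s c x hr (Ne.symm hx))
  · rintro (rfl | hx)
    · exact SimpleGraph.Reachable.refl _
    · exact hx.reachable

/-- `D.HasGallery w x y`: there is a gallery of type `w` from `x` to `y`. -/
def HasGallery : List S → C → C → Prop
  | [], x, y => x = y
  | s :: w, x, y => ∃ z, (D.graph s).Adj x z ∧ HasGallery w z y

/-- Every panel has at least three chambers. -/
def IsThick : Prop := ∀ (s : S) (c : C), 3 ≤ (D.panel s c).encard

/-- For each `s`, all `s`-panels have the same cardinality. -/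
def IsSemiRegular : Prop :=
  ∀ (s : S) (c d : C), Cardinal.mk (D.panel s c) = Cardinal.mk (D.panel s d)

/-- The group of type-preserving automorphisms. -/
def autGroup : Subgroup (Equiv.Perm C) where
  carrier := {g | ∀ (s : S) (x y : C), (D.graph s).Adj (g x) (g y) ↔ (D.graph s).Adj x y}
  one_mem' := fun _ _ _ => Iff.rfl
  mul_mem' := fun {g h} hg hh s x y => (hg s (h x) (h y)).trans (hh s x y)
  inv_mem' := fun {g} hg s x y => by
    have h := hg s (g⁻¹ x) (g⁻¹ y)
    rw [← Equiv.Perm.mul_apply, ← Equiv.Perm.mul_apply, mul_inv_cancel, Equiv.Perm.one_apply,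
      Equiv.Perm.one_apply] at h
    exact h.symm

end ChamberSystem

/-- A building of type `(W, S)` with set of chambers `C`: a chamber system with index set `S`
together with a Weyl distance. -/
structure Building {S W : Type*} [Group W] {M : CoxeterMatrix S} (cs : CoxeterSystem M W)
    (C : Type*) extends ChamberSystem S C where
  /-- The Weyl distance. -/
  δ : C → C → W
  δ_eq_iff : ∀ w : List S, cs.IsReduced w → ∀ x y : C,
    δ x y = cs.wordProd w ↔ toChamberSystem.HasGallery w x y

/-- The thin building of type `(W, S)` on the set of chambers `W`, in which `x` and `y` are
`s`-adjacent if and only if `x⁻¹ * y = s`, with Weyl distance `x⁻¹ * y`. -/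
def thinBuilding {S W : Type*} [Group W] {M : CoxeterMatrix S} (cs : CoxeterSystem M W) :
    Building cs W where
  graph s :=
    { Adj := fun x y => x⁻¹ * y = cs.simple s
      symm := ⟨fun x y h => by
        have h' := congrArg (·⁻¹) h
        simpa using h'⟩
      loopless := ⟨fun x h => by
        have h' := congrArg cs.length h
        simp at h'⟩ }
  panel_complete s x y h hxy := by
    obtain ⟨p⟩ := h
    have key : x = y ∨ x⁻¹ * y = cs.simple s := by
      clear hxy
      induction p with
      | nil => exact Or.inl rfl
      | @cons u v w huv p ih =>
        have huv' : v = u * cs.simple s := by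
          rw [← (show u⁻¹ * v = cs.simple s from huv)]; group
        rcases ih with rfl | ih
        · exact Or.inr huv
        · left
          have hw : w = v * cs.simple s := by rw [← ih]; group
          rw [hw, huv', mul_assoc, cs.simple_mul_simple_self, mul_one]
    exact key.resolve_left hxy
  panel_nontrivial s x := ⟨x * cs.simple s, by simp⟩
  δ x y := x⁻¹ * y
  δ_eq_iff w _ := by
    induction w with
    | nil =>
      intro x y
      simp [ChamberSystem.HasGallery, inv_mul_eq_one]
    | cons s w ih =>
      rename_i hw
      have hw' : cs.IsReduced w := by simpa using hw.drop 1
      intro x y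
      constructor
      · intro h
        refine ⟨x * cs.simple s, by simp, (ih hw' _ _).1 ?_⟩
        rw [cs.wordProd_cons] at h
        rw [mul_inv_rev, mul_assoc, h, cs.inv_simple, cs.simple_mul_simple_cancel_left]
      · rintro ⟨z, hz, hg⟩
        have h1 : z⁻¹ * y = cs.wordProd w := (ih hw' z y).2 hg
        have h2 : x⁻¹ * z = cs.simple s := hz
        rw [cs.wordProd_cons, ← h1, ← h2]
        group

namespace Building

variable {S W C : Type*} [Group W] {M : CoxeterMatrix S} {cs : CoxeterSystem M W}
  (D : Building cs C)

/-- The gallery distance. -/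
noncomputable def dist (x y : C) : ℕ := cs.length (D.δ x y)

/-- `f` is a `δ`-isometric embedding of the thin building of type `(W, S)` into `D`. -/
def IsThinIsometry (f : W → C) : Prop := ∀ x y : W, D.δ (f x) (f y) = (thinBuilding cs).δ x y

/-- The apartments of `D`, given by their sets of chambers: the subbuildings that are
`δ`-isometric to the thin building. -/
def IsApartment (A : Set C) : Prop := ∃ f : W → C, D.IsThinIsometry f ∧ Set.range f = A

/-- The roots of the thin building of type `(W, S)`: for an edge `{x, y}`, the set of chambers
that are nearer to `x` than to `y`. (An edge `{x, y}`, with `y = x * s`, lies in the wall of exactly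
one reflection, namely `x * s * x⁻¹`, and the roots of a reflection are those defined
by the edges in its wall.) -/
def IsThinRoot (cs : CoxeterSystem M W) (β : Set W) : Prop :=
  ∃ (s : S) (x y : W), ((thinBuilding cs).graph s).Adj x y ∧
    β = {w | (thinBuilding cs).dist w x < (thinBuilding cs).dist w y}

/-- `α` is a root of the apartment `A`. -/
def IsRootOf (A α : Set C) : Prop :=
  ∃ f : W → C, D.IsThinIsometry f ∧ Set.range f = A ∧ ∃ β : Set W, IsThinRoot cs β ∧ α = f '' β

/-- The wall of the root `α` of the apartment `A`: the set of panels of `D` having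
chambers both in `α` and in the opposite root `A \ α`. -/
def wall (A α : Set C) : Set (Set C) :=
  {P | (∃ (s : S) (c : C), P = D.panel s c) ∧ (P ∩ α).Nonempty ∧ (P ∩ (A \ α)).Nonempty}

/-- `p` is the projection of `x` on `R`: the unique chamber of `R` closest to `x`. -/
def IsProj (R : Set C) (x p : C) : Prop :=
  p ∈ R ∧ ∀ q ∈ R, q ≠ p → D.dist x p < D.dist x q

/-- The `s`-wing of `c`: the set of chambers whose projection on the `s`-panel of `c` is `c`. -/
def wing (s : S) (c : C) : Set C := {x | D.IsProj (D.panel s c) x c}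

/-- The fixator of the `s`-wing of `c` in the group of type-preserving automorphisms. If `c` lies in
a root `α` and the `s`-panel of `c` belongs to the wall of `α`, this is the root wing group
of `α`. -/
def wingGroup (s : S) (c : C) : Subgroup D.autGroup := fixingSubgroup D.autGroup (D.wing s c)

end Building

/-! A colouring based at `c` gives every chamber `x` a `u`-colour in the `u`-panel of `c`, for each
generator `u`. It is bijective on `u`-panels, is constant along galleries whose colours commute with
`u`, and equals `c` exactly at the chamber of each `u`-panel nearest to `c`. Semi-regularity
provides one (`exists_isBasedColouring`), because a residue of type `u` and its commuting generators
is the product of a `u`-panel and a residue of the commuting type.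

Two colourings `h`, `h'` with the same base differ by an automorphism: a geodesic gallery from `c`
is copied step by step, matching types and colours. The endpoint does not depend on the gallery
(`Lift.unique`), since two different last letters of a reduced word must commute and the resulting
square can be copied as a whole.

Now let `f`, `f'` parametrise two apartments containing the root, with `1` sent to `c`; they agree
on the root. In each product residue the `u`-colours are permuted by at most one transposition,
giving `h'` with `h' u (f' w) = h u (f w)` and `h' = h` on the wing (`exists_colour_perm`). The
automorphism from `h` to `h'` then fixes the wing and carries `f w` to `f' w`. The transpositions
are consistent by `colour_eq_of_wallSetoid` and leave the wing alone by `colour_eq_of_wing`. -/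

namespace CoxeterSystem

variable {S W : Type*} [Group W] {M : CoxeterMatrix S}

/-! ### Right-angled Coxeter groups: parity of wall crossings and descents -/

theorem simple_ne_of_isRightAngled (hM : M.IsRightAngled) (cs : CoxeterSystem M W) {s t : S}
    (hst : s ≠ t) : cs.simple s ≠ cs.simple t := by
  classical
  have hf : M.IsLiftable (fun i : S => if i = s then Multiplicative.ofAdd (1 : ZMod 2) else 1) := by
    have h2 : ∀ a : Multiplicative (ZMod 2), a * a = 1 := by decide
    intro i j
    by_cases hij : i = j
    · subst hij
      rw [h2, one_pow]
    · rcases hM i j hij with h | h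
      · rw [h, pow_two, h2]
      · rw [h, pow_zero]
  intro h
  have h' := congrArg (cs.lift ⟨_, hf⟩) h
  rw [cs.lift_apply_simple hf, cs.lift_apply_simple hf, if_pos rfl, if_neg hst.symm] at h'
  exact absurd h' (by decide)

theorem simple_comm (cs : CoxeterSystem M W) {s t : S} (h : M s t = 2) :
    cs.simple s * cs.simple t = cs.simple t * cs.simple s := by
  have h1 := cs.simple_mul_simple_pow s t
  rw [h, pow_two] at h1
  have h2 := eq_inv_of_mul_eq_one_left h1
  rwa [mul_inv_rev, cs.inv_simple, cs.inv_simple] at h2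

theorem ne_of_commute {s t : S} (h : M s t = 2) : s ≠ t := by
  rintro rfl
  rw [M.diagonal] at h
  omega

open Classical in
/-- The action of a generator on pairs consisting of a group element and a parity. -/
noncomputable def parityStep (cs : CoxeterSystem M W) (s : S) (p : W × ZMod 2) : W × ZMod 2 :=
  (cs.simple s * p.1 * cs.simple s, p.2 + if p.1 = cs.simple s then 1 else 0)

/-- Only involutions and commuting pairs have to be checked, as pairs with entry `∞` impose no
relation. In a commuting pair, conjugation by one generator does not affect whether an element
equals the other, so the parity increments agree. -/
theorem isLiftable_parityStep (hM : M.IsRightAngled) (cs : CoxeterSystem M W) :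
    M.IsLiftable (G := Function.End (W × ZMod 2)) cs.parityStep := by
  classical
  let f : S → Function.End (W × ZMod 2) := cs.parityStep
  have hself : ∀ i, f i * f i = 1 := by
    intro i
    funext p
    obtain ⟨x, z⟩ := p
    have h : cs.simple i * x * cs.simple i = cs.simple i ↔ x = cs.simple i := by
      constructor
      · intro h
        have := congrArg (fun y => cs.simple i * y * cs.simple i) h
        simpa [mul_assoc] using this
      · rintro rfl
        simp
    have hz : ∀ a : ZMod 2, a + a = 0 := by decide
    change cs.parityStep i (cs.parityStep i (x, z)) = (x, z)
    simp only [parityStep, h, Prod.mk.injEq]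
    exact ⟨by simp [mul_assoc], by rw [add_assoc, hz, add_zero]⟩
  intro i j
  change (f i * f j) ^ M i j = 1
  by_cases hij : i = j
  · subst hij
    rw [hself, one_pow]
  · rcases hM i j hij with h | h
    · have hcomm : f i * f j = f j * f i := by
        have key : ∀ i j, M i j = 2 → ∀ x,
            (cs.simple i * x * cs.simple i = cs.simple j ↔ x = cs.simple j) := by
          intro i j h x
          have hc := cs.simple_comm h
          constructor
          · intro h
            have := congrArg (fun y => cs.simple i * y * cs.simple i) h
            simpa [mul_assoc, ← hc] using this
          · rintro rfl
            rw [hc]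
            simp
        funext p
        obtain ⟨x, z⟩ := p
        have hc := cs.simple_comm h
        change cs.parityStep i (cs.parityStep j (x, z)) = cs.parityStep j (cs.parityStep i (x, z))
        simp only [parityStep, key i j h, key j i (M.symmetric i j ▸ h), Prod.mk.injEq]
        refine ⟨?_, by ring⟩
        calc _ = (cs.simple i * cs.simple j) * x * (cs.simple j * cs.simple i) := by
              simp only [mul_assoc]
          _ = _ := by rw [hc]; simp only [mul_assoc]; rw [hc]
      rw [h, pow_two]
      calc _ = f i * (f j * f i) * f j := by
            simp only [mul_assoc]
        _ = _ := by rw [← hcomm, ← mul_assoc, hself, one_mul, hself]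
    · rw [h, pow_zero]

/-- The action of `W` on pairs consisting of a group element and a parity. -/
noncomputable def parityAct (hM : M.IsRightAngled) (cs : CoxeterSystem M W) (w : W) :
    W × ZMod 2 → W × ZMod 2 :=
  cs.lift ⟨_, cs.isLiftable_parityStep hM⟩ w

/-- The parity of the number of times a gallery from `1` to `w⁻¹` crosses the wall of the
reflection `x`. -/
noncomputable def parity (hM : M.IsRightAngled) (cs : CoxeterSystem M W) (w x : W) : ZMod 2 :=
  (cs.parityAct hM w (x, 0)).2

variable (hM : M.IsRightAngled) (cs : CoxeterSystem M W)

theorem parityAct_one (p : W × ZMod 2) : cs.parityAct hM 1 p = p := by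
  rw [parityAct, map_one]
  rfl

theorem parityAct_mul (v w : W) (p : W × ZMod 2) :
    cs.parityAct hM (v * w) p = cs.parityAct hM v (cs.parityAct hM w p) := by
  rw [parityAct, map_mul]
  rfl

theorem parityAct_simple (s : S) (p : W × ZMod 2) :
    cs.parityAct hM (cs.simple s) p = cs.parityStep s p := by
  rw [parityAct, cs.lift_apply_simple (cs.isLiftable_parityStep hM)]

theorem parity_one (x : W) : cs.parity hM 1 x = 0 := by
  rw [parity, parityAct_one]

open Classical in
theorem parity_simple (s : S) (x : W) :
    cs.parity hM (cs.simple s) x = if x = cs.simple s then 1 else 0 := by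
  rw [parity, parityAct_simple]
  simp [parityStep]

theorem parityAct_apply (w x : W) (z : ZMod 2) :
    cs.parityAct hM w (x, z) = (w * x * w⁻¹, z + cs.parity hM w x) := by
  induction w using cs.simple_induction_left generalizing z with
  | one => rw [parityAct_one, parity_one]; simp
  | mul_simple_left w i ih =>
    rw [parity, parityAct_mul, parityAct_mul, ih, ih, parityAct_simple, parityAct_simple]
    simp only [parityStep, Prod.mk.injEq]
    exact ⟨by simp [mul_assoc], by ring⟩

theorem parity_mul (v w x : W) :
    cs.parity hM (v * w) x = cs.parity hM w x + cs.parity hM v (w * x * w⁻¹) := by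
  rw [parity, parityAct_mul, parityAct_apply, parityAct_apply, zero_add]

theorem mem_rightInvSeq_of_parity {ω : List S} {x : W} (h : cs.parity hM (cs.wordProd ω) x = 1) :
    x ∈ cs.rightInvSeq ω := by
  classical
  induction ω with
  | nil =>
    rw [wordProd_nil, parity_one] at h
    exact absurd h (by decide)
  | cons i ω ih =>
    rw [wordProd_cons, parity_mul, parity_simple] at h
    rw [rightInvSeq, List.mem_cons]
    by_cases hx : cs.wordProd ω * x * (cs.wordProd ω)⁻¹ = cs.simple i
    · left
      rw [← hx]
      group
    · rw [if_neg hx, add_zero] at h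
      exact Or.inr (ih h)

theorem length_mul_lt_of_parity {w x : W} (h : cs.parity hM w x = 1) :
    cs.length (w * x) < cs.length w := by
  obtain ⟨ω, hω, rfl⟩ := cs.exists_isReduced w
  exact (cs.isRightInversion_of_mem_rightInvSeq hω (cs.mem_rightInvSeq_of_parity hM h)).2

theorem zmod_two_eq_zero_or_one (a : ZMod 2) : a = 0 ∨ a = 1 := by
  revert a
  decide

/-- Multiplying by `s` flips the parity at `s`, so exactly one of `w` and `w * s` has parity one
there, and parity one forces the length to drop. -/
theorem isRightDescent_iff_parity {w : W} {s : S} :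
    cs.IsRightDescent w s ↔ cs.parity hM w (cs.simple s) = 1 := by
  refine ⟨fun h => ?_, cs.length_mul_lt_of_parity hM⟩
  have h1 : cs.parity hM (w * cs.simple s) (cs.simple s) ≠ 1 := by
    intro h'
    have h2 := cs.length_mul_lt_of_parity hM h'
    rw [cs.simple_mul_simple_cancel_right] at h2
    exact lt_asymm h h2
  rw [parity_mul, parity_simple, if_pos rfl] at h1
  simp only [cs.simple_mul_simple_self, one_mul, cs.inv_simple] at h1
  rcases zmod_two_eq_zero_or_one (cs.parity hM w (cs.simple s)) with h2 | h2
  · rw [h2] at h1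
    exact absurd (add_zero _) h1
  · exact h2

include hM in
theorem isRightDescent_mul_simple_iff_of_commute {w : W} {t u : S} (h : M t u = 2) :
    cs.IsRightDescent (w * cs.simple t) u ↔ cs.IsRightDescent w u := by
  rw [cs.isRightDescent_iff_parity hM, cs.isRightDescent_iff_parity hM, parity_mul, parity_simple,
    if_neg (cs.simple_ne_of_isRightAngled hM (ne_of_commute h).symm), cs.simple_comm h,
    cs.inv_simple, cs.simple_mul_simple_cancel_right, zero_add]

include hM in
/-- For non-commuting generators `s, t`, the group maps onto the infinite dihedral group acting
on the integers. -/
theorem exists_hom_perm_int {s t : S} (h : M s t = 0) :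
    ∃ φ : W →* Equiv.Perm ℤ, (∀ n, φ (cs.simple s) n = -n) ∧ ∀ n, φ (cs.simple t) n = 1 - n := by
  classical
  have hst : s ≠ t := by
    rintro rfl
    rw [M.diagonal] at h
    omega
  -- Generators other than `s` and `t` act trivially. Since `M s t = 0`, a pair of distinct
  -- generators with entry `2` contains such a generator, and its relation holds.
  let f : S → Equiv.Perm ℤ := fun i =>
    if i = s then Equiv.subLeft 0 else if i = t then Equiv.subLeft 1 else 1
  have hself : ∀ i, f i * f i = 1 := by
    intro i
    ext n
    simp only [f]
    split_ifs <;> simp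
  have hf : M.IsLiftable f := by
    intro i j
    by_cases hij : i = j
    · subst hij
      rw [hself, one_pow]
    · rcases hM i j hij with h' | h'
      · rw [h']
        have : f i = 1 ∨ f j = 1 := by
          by_contra! hcon
          have hi : i = s ∨ i = t := by
            by_contra! hi
            exact hcon.1 (by simp [f, hi])
          have hj : j = s ∨ j = t := by
            by_contra! hj
            exact hcon.2 (by simp [f, hj])
          have h2 : M t s = 0 := M.symmetric s t ▸ h
          rcases hi with rfl | rfl <;> rcases hj with rfl | rfl <;>
            first | exact hij rfl | omega
        rcases this with h1 | h1
        · rw [h1, one_mul, pow_two, hself]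
        · rw [h1, mul_one, pow_two, hself]
      · rw [h', pow_zero]
  refine ⟨cs.lift ⟨f, hf⟩, fun n => ?_, fun n => ?_⟩
  · rw [cs.lift_apply_simple hf]
    simp [f]
  · rw [cs.lift_apply_simple hf]
    simp [f, hst.symm]

end CoxeterSystem

/-! ### Non-commuting generators are never both right descents -/

namespace CoxeterSystem

variable {S W : Type*} [Group W] {M : CoxeterMatrix S}
variable (hM : M.IsRightAngled) (cs : CoxeterSystem M W)

/-- The walls crossed an odd number of times by an alternating word ending in `s` act as reflections
of the line lying on the side of `s` away from `t`. With `ε = ±1`, the reflection of `t` itself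
would need `j = -1`, which is how `t` is later excluded as a descent. -/
theorem perm_int_of_parity {s t : S} {φ : W →* Equiv.Perm ℤ} {α ε : ℤ}
    (hs : ∀ n, φ (cs.simple s) n = α - n) (ht : ∀ n, φ (cs.simple t) n = α + ε - n)
    (k : ℕ) (x : W) (hx : cs.parity hM ((cs.simple t * cs.simple s) ^ k) x = 1) :
    ∃ j : ℕ, ∀ n, φ x n = α - ε * j - n := by
  classical
  induction k generalizing x with
  | zero =>
    rw [pow_zero, parity_one] at hx
    exact absurd hx (by decide)
  | succ k ih =>
    rw [pow_succ, parity_mul, parity_mul, parity_simple, parity_simple] at hx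
    by_cases h1 : x = cs.simple s
    · subst h1
      exact ⟨0, fun n => by rw [hs]; simp⟩
    by_cases h2 : cs.simple s * x * (cs.simple s)⁻¹ = cs.simple t
    · have h3 : x = cs.simple s * cs.simple t * cs.simple s := by
        rw [← h2]
        simp [mul_assoc]
      refine ⟨1, fun n => ?_⟩
      rw [h3]
      simp only [map_mul, Equiv.Perm.mul_apply, hs, ht]
      push_cast
      ring
    rw [if_neg h1, if_neg h2, zero_add, zero_add] at hx
    obtain ⟨j, hj⟩ := ih _ hx
    have h3 : x = cs.simple s * cs.simple t *
        (cs.simple t * cs.simple s * x * (cs.simple t * cs.simple s)⁻¹) *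
        (cs.simple t * cs.simple s) := by
      simp [mul_assoc]
    -- The last two letters account for the walls with index 0 and 1; conjugating by them shifts the
    -- remaining walls by 2.
    refine ⟨j + 2, fun n => ?_⟩
    rw [h3, map_mul, map_mul, Equiv.Perm.mul_apply, Equiv.Perm.mul_apply, hj]
    simp only [map_mul, Equiv.Perm.mul_apply, hs, ht]
    push_cast
    ring

theorem perm_int_of_parity_simple_mul {s t : S} {φ : W →* Equiv.Perm ℤ} {α ε : ℤ}
    (hs : ∀ n, φ (cs.simple s) n = α - n) (ht : ∀ n, φ (cs.simple t) n = α + ε - n)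
    (k : ℕ) (x : W)
    (hx : cs.parity hM (cs.simple s * (cs.simple t * cs.simple s) ^ k) x = 1) :
    ∃ j : ℕ, ∀ n, φ x n = α - ε * j - n := by
  classical
  rw [parity_mul, parity_simple] at hx
  by_cases h1 : (cs.simple t * cs.simple s) ^ k * x * ((cs.simple t * cs.simple s) ^ k)⁻¹ =
      cs.simple s
  · have h2 : x = ((cs.simple t * cs.simple s) ^ k)⁻¹ * cs.simple s *
        (cs.simple t * cs.simple s) ^ k := by
      generalize (cs.simple t * cs.simple s) ^ k = q at h1 ⊢
      rw [← h1]
      group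
    have h3 : ∀ n, φ ((cs.simple t * cs.simple s) ^ k) n = n + ε * k := by
      clear hx h1 h2
      induction k with
      | zero => simp
      | succ k ih =>
        intro n
        rw [pow_succ, map_mul, Equiv.Perm.mul_apply, ih]
        simp only [map_mul, Equiv.Perm.mul_apply, hs, ht]
        push_cast
        ring
    refine ⟨2 * k, fun n => ?_⟩
    rw [h2, map_mul, map_mul, map_inv, Equiv.Perm.mul_apply, Equiv.Perm.mul_apply,
      Equiv.Perm.inv_eq_iff_eq, h3, h3, hs]
    push_cast
    ring
  · rw [if_neg h1, add_zero] at hx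
    exact cs.perm_int_of_parity hM hs ht k x hx

theorem exists_pow_of_mem_closure {a b : W} (ha : a * a = 1) (hb : b * b = 1) {x : W}
    (hx : x ∈ Subgroup.closure {a, b}) :
    ∃ k : ℕ, (x = (b * a) ^ k ∨ x = a * (b * a) ^ k) ∨ (x = (a * b) ^ k ∨ x = b * (a * b) ^ k) := by
  have ha' : a⁻¹ = a := inv_eq_of_mul_eq_one_left ha
  have hb' : b⁻¹ = b := inv_eq_of_mul_eq_one_left hb
  have key : ∀ {a b : W}, a * a = 1 → ∀ y : W,
      (∃ k : ℕ, (y = (b * a) ^ k ∨ y = a * (b * a) ^ k) ∨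
        (y = (a * b) ^ k ∨ y = b * (a * b) ^ k)) →
      ∃ k : ℕ, (a * y = (b * a) ^ k ∨ a * y = a * (b * a) ^ k) ∨
        (a * y = (a * b) ^ k ∨ a * y = b * (a * b) ^ k) := by
    rintro a b ha y ⟨k, (rfl | rfl) | (rfl | rfl)⟩
    · exact ⟨k, Or.inl (Or.inr rfl)⟩
    · exact ⟨k, Or.inl (Or.inl (by rw [← mul_assoc, ha, one_mul]))⟩
    · cases k with
      | zero => exact ⟨0, Or.inl (Or.inr (by simp))⟩
      | succ k =>
        refine ⟨k, Or.inr (Or.inr ?_)⟩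
        rw [pow_succ', ← mul_assoc, ← mul_assoc, ha, one_mul]
    · exact ⟨k + 1, Or.inr (Or.inl (by rw [pow_succ', mul_assoc]))⟩
  induction hx using Subgroup.closure_induction_left with
  | one => exact ⟨0, Or.inl (Or.inl (by simp))⟩
  | mul_left x hx y _ ih =>
    rcases hx with rfl | rfl
    · exact key ha y ih
    · obtain ⟨k, h⟩ := ih
      -- Exchanging `a` and `b` swaps the two halves of the disjunction, so the case of `b` is `key`
      -- with the roles reversed.
      obtain ⟨k', h'⟩ := key hb y ⟨k, h.symm⟩
      exact ⟨k', h'.symm⟩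
  | inv_mul_cancel x hx y _ ih =>
    rcases hx with rfl | rfl
    · rw [ha']
      exact key ha y ih
    · obtain ⟨k, h⟩ := ih
      obtain ⟨k', h'⟩ := key hb y ⟨k, h.symm⟩
      rw [hb']
      exact ⟨k', h'.symm⟩

include hM in
/-- No element has two right descents that generate an infinite dihedral group. -/
theorem not_isRightDescent_of_infinite {w : W} {s t : S} (h : M s t = 0)
    (hs : cs.IsRightDescent w s) : ¬ cs.IsRightDescent w t := by
  intro ht
  obtain ⟨φ, hφs, hφt⟩ := cs.exists_hom_perm_int hM h
  let H : Subgroup W := Subgroup.closure {cs.simple s, cs.simple t}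
  have hsH : cs.simple s ∈ H := Subgroup.subset_closure (by simp)
  have htH : cs.simple t ∈ H := Subgroup.subset_closure (by simp)
  -- A shortest `v` in the coset `w * H`. Any reflection of `H` that is a descent of `w = v * b`
  -- must come from `b`: otherwise `v` could be shortened inside its coset.
  obtain ⟨v, hv, hmin⟩ := WellFounded.has_min (measure cs.length).wf {v | v⁻¹ * w ∈ H}
    ⟨w, by simp [H.one_mem]⟩
  have hv : v⁻¹ * w ∈ H := hv
  obtain ⟨b, hb⟩ : ∃ b, b = v⁻¹ * w := ⟨_, rfl⟩
  have hw : w = v * b := by rw [hb]; group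
  rw [← hb] at hv
  have key : ∀ r, cs.simple r ∈ H → cs.IsRightDescent w r → cs.parity hM b (cs.simple r) = 1 := by
    intro r hr hd
    rw [cs.isRightDescent_iff_parity hM, hw, parity_mul] at hd
    rcases zmod_two_eq_zero_or_one (cs.parity hM v (b * cs.simple r * b⁻¹)) with h0 | h1
    · rwa [h0, add_zero] at hd
    · refine absurd (cs.length_mul_lt_of_parity hM h1) (hmin _ ?_)
      have hx : b * cs.simple r * b⁻¹ ∈ H := H.mul_mem (H.mul_mem hv hr) (H.inv_mem hv)
      have : (v * (b * cs.simple r * b⁻¹))⁻¹ * w = (b * cs.simple r * b⁻¹)⁻¹ * b := by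
        rw [hw]
        group
      change _ ∈ H
      rw [this]
      exact H.mul_mem (H.inv_mem hx) hv
  have ks := key s hsH hs
  have kt := key t htH ht
  have h1 : ∀ n, φ (cs.simple s) n = 0 - n := fun n => by rw [hφs, zero_sub]
  have h2 : ∀ n, φ (cs.simple t) n = 0 + 1 - n := fun n => by rw [hφt, zero_add]
  have h3 : ∀ n, φ (cs.simple s) n = 1 + -1 - n := fun n => by rw [hφs]; ring
  obtain ⟨k, (hk | hk) | (hk | hk)⟩ := exists_pow_of_mem_closure (cs.simple_mul_simple_self s)
    (cs.simple_mul_simple_self t) hv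
  · rw [hk] at kt
    obtain ⟨j, hj⟩ := cs.perm_int_of_parity hM h1 h2 k _ kt
    have := hj 0
    rw [hφt] at this
    omega
  · rw [hk] at kt
    obtain ⟨j, hj⟩ := cs.perm_int_of_parity_simple_mul hM h1 h2 k _ kt
    have := hj 0
    rw [hφt] at this
    omega
  · rw [hk] at ks
    obtain ⟨j, hj⟩ := cs.perm_int_of_parity hM hφt h3 k _ ks
    have := hj 0
    rw [hφs] at this
    omega
  · rw [hk] at ks
    obtain ⟨j, hj⟩ := cs.perm_int_of_parity_simple_mul hM hφt h3 k _ ks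
    have := hj 0
    rw [hφs] at this
    omega

include hM in
theorem commute_of_isRightDescent {w : W} {s t : S} (hst : s ≠ t) (hs : cs.IsRightDescent w s)
    (ht : cs.IsRightDescent w t) : M s t = 2 :=
  (hM s t hst).resolve_right fun h => cs.not_isRightDescent_of_infinite hM h hs ht

end CoxeterSystem

/-! ### Panels and galleries -/

namespace ChamberSystem

variable {S C : Type*} (D : ChamberSystem S C)

theorem mem_panel_self (s : S) (x : C) : x ∈ D.panel s x := D.mem_panel_iff.2 (Or.inl rfl)

variable {D}

theorem mem_panel_of_adj {s : S} {x y : C} (h : (D.graph s).Adj x y) : y ∈ D.panel s x :=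
  D.mem_panel_iff.2 (Or.inr h)

theorem mem_panel_symm {s : S} {x y : C} (h : y ∈ D.panel s x) : x ∈ D.panel s y := by
  rcases D.mem_panel_iff.1 h with rfl | h
  · exact D.mem_panel_self s _
  · exact mem_panel_of_adj h.symm

theorem mem_panel_trans {s : S} {x y z : C} (h : y ∈ D.panel s x) (h' : z ∈ D.panel s y) :
    z ∈ D.panel s x := by
  rcases D.mem_panel_iff.1 h with rfl | h
  · exact h'
  rcases D.mem_panel_iff.1 h' with rfl | h'
  · exact mem_panel_of_adj h
  by_cases hxz : x = z
  · subst hxz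
    exact D.mem_panel_self s _
  · exact mem_panel_of_adj (D.panel_complete s x z (h.reachable.trans h'.reachable) hxz)

theorem adj_of_mem_panel {s : S} {c x y : C} (hx : x ∈ D.panel s c) (hy : y ∈ D.panel s c)
    (hxy : x ≠ y) : (D.graph s).Adj x y :=
  (D.mem_panel_iff.1 (mem_panel_trans (mem_panel_symm hx) hy)).resolve_left hxy.symm

theorem hasGallery_append {w w' : List S} {x y : C} :
    D.HasGallery (w ++ w') x y ↔ ∃ z, D.HasGallery w x z ∧ D.HasGallery w' z y := by
  induction w generalizing x with
  | nil => simp [HasGallery]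
  | cons s w ih =>
    simp only [List.cons_append, HasGallery, ih]
    constructor
    · rintro ⟨a, ha, z, hz, h⟩
      exact ⟨z, ⟨a, ha, hz⟩, h⟩
    · rintro ⟨z, ⟨a, ha, hz⟩, h⟩
      exact ⟨a, ha, z, hz, h⟩

theorem hasGallery_singleton {s : S} {x y : C} :
    D.HasGallery [s] x y ↔ (D.graph s).Adj x y := by
  simp [HasGallery]

theorem hasGallery_reverse {w : List S} {x y : C} (h : D.HasGallery w x y) :
    D.HasGallery w.reverse y x := by
  induction w generalizing x with
  | nil => exact Eq.symm h
  | cons s w ih =>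
    obtain ⟨z, hz, h⟩ := h
    rw [List.reverse_cons, hasGallery_append]
    exact ⟨z, ih h, hasGallery_singleton.2 hz.symm⟩

theorem hasGallery_map {g : Equiv.Perm C} (hg : g ∈ D.autGroup) {w : List S} {x y : C} :
    D.HasGallery w (g x) (g y) ↔ D.HasGallery w x y := by
  have key : ∀ g ∈ D.autGroup, ∀ x y, D.HasGallery w x y → D.HasGallery w (g x) (g y) := by
    intro g hg x y h
    induction w generalizing x with
    | nil => exact congrArg g h
    | cons s w ih =>
      obtain ⟨z, hz, h⟩ := h
      exact ⟨g z, (hg s x z).2 hz, ih z h⟩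
  refine ⟨fun h => ?_, key g hg x y⟩
  simpa using key g⁻¹ (D.autGroup.inv_mem hg) _ _ h

end ChamberSystem

namespace CoxeterSystem

variable {S W : Type*} [Group W] {M : CoxeterMatrix S} (cs : CoxeterSystem M W)

theorem isRightDescent_mul_simple_self {w : W} {s : S} (h : ¬ cs.IsRightDescent w s) :
    cs.IsRightDescent (w * cs.simple s) s := by
  rw [cs.isRightDescent_iff_not_isRightDescent_mul]
  simpa using h

theorem exists_isReduced_concat {w : W} {s : S} (h : cs.IsRightDescent w s) :
    ∃ ω : List S, cs.IsReduced (ω ++ [s]) ∧ cs.IsReduced ω ∧ w = cs.wordProd (ω ++ [s]) ∧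
      w * cs.simple s = cs.wordProd ω := by
  obtain ⟨ω, hω, hw⟩ := cs.exists_isReduced (w * cs.simple s)
  have hw' : w = cs.wordProd (ω ++ [s]) := by
    rw [wordProd_append, wordProd_singleton, ← hw]
    simp
  refine ⟨ω, ?_, hω, hw', hw⟩
  rw [IsReduced, ← hw', List.length_append, List.length_singleton, ← hω.eq, ← hw]
  exact (cs.isRightDescent_iff.1 h).symm

end CoxeterSystem

/-! ### Weyl distance, gates of panels, and residues of product type -/

namespace Building

open ChamberSystem CoxeterSystem

variable {S W C : Type*} [Group W] {M : CoxeterMatrix S} {cs : CoxeterSystem M W}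
  (D : Building cs C)

theorem δ_eq_one_iff {x y : C} : D.δ x y = 1 ↔ x = y := by
  have h := D.δ_eq_iff [] (by simp [CoxeterSystem.IsReduced]) x y
  rwa [cs.wordProd_nil] at h

theorem δ_self (x : C) : D.δ x x = 1 := D.δ_eq_one_iff.2 rfl

theorem δ_eq_simple_iff {s : S} {x y : C} : D.δ x y = cs.simple s ↔ (D.graph s).Adj x y := by
  have h := D.δ_eq_iff [s] (by simp [CoxeterSystem.IsReduced]) x y
  rwa [cs.wordProd_singleton, hasGallery_singleton] at h

theorem δ_inv (x y : C) : (D.δ x y)⁻¹ = D.δ y x := by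
  obtain ⟨ω, hω, hw⟩ := cs.exists_isReduced (D.δ x y)
  rw [hw, ← cs.wordProd_reverse, eq_comm, D.δ_eq_iff _ hω.reverse]
  exact hasGallery_reverse ((D.δ_eq_iff _ hω _ _).1 hw)

variable {D}

theorem δ_map {g : Equiv.Perm C} (hg : g ∈ D.autGroup) (x y : C) : D.δ (g x) (g y) = D.δ x y := by
  obtain ⟨ω, hω, hw⟩ := cs.exists_isReduced (D.δ x y)
  rw [hw, D.δ_eq_iff _ hω, hasGallery_map hg, ← D.δ_eq_iff _ hω, hw]

/-- Throughout, `s` failing to be a right descent of `δ z x` means that `x` is the gate of its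
`s`-panel as seen from `z`; a reduced gallery to the gate then extends to a reduced gallery to any
other chamber of the panel. -/
theorem δ_eq_mul_of_not_isRightDescent {s : S} {x y : C} (h : (D.graph s).Adj x y) {z : C}
    (hs : ¬ cs.IsRightDescent (D.δ z x) s) : D.δ z y = D.δ z x * cs.simple s := by
  obtain ⟨ω, hω, hω', hw, hw'⟩ :=
    cs.exists_isReduced_concat (cs.isRightDescent_mul_simple_self hs)
  rw [cs.simple_mul_simple_cancel_right] at hw'
  rw [hw, D.δ_eq_iff _ hω, hasGallery_append]
  exact ⟨x, (D.δ_eq_iff _ hω' _ _).1 hw', hasGallery_singleton.2 h⟩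

theorem exists_adj_of_isRightDescent {s : S} {z x : C} (hs : cs.IsRightDescent (D.δ z x) s) :
    ∃ y, (D.graph s).Adj y x ∧ D.δ z y = D.δ z x * cs.simple s := by
  obtain ⟨ω, hω, hω', hw, hw'⟩ := cs.exists_isReduced_concat hs
  obtain ⟨y, hy, hyx⟩ := hasGallery_append.1 ((D.δ_eq_iff _ hω _ _).1 hw)
  exact ⟨y, hasGallery_singleton.1 hyx, by rw [hw', D.δ_eq_iff _ hω']; exact hy⟩

theorem eq_of_not_isRightDescent {s : S} {x y z : C} (h : y ∈ D.panel s x)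
    (hx : ¬ cs.IsRightDescent (D.δ z x) s) (hy : ¬ cs.IsRightDescent (D.δ z y) s) : x = y := by
  rcases D.mem_panel_iff.1 h with h | h
  · exact h.symm
  · rw [δ_eq_mul_of_not_isRightDescent h hx] at hy
    exact absurd (cs.isRightDescent_mul_simple_self hx) hy

variable (D)

theorem exists_gate (z x : C) (s : S) :
    ∃ p ∈ D.panel s x, ¬ cs.IsRightDescent (D.δ z p) s := by
  by_cases h : cs.IsRightDescent (D.δ z x) s
  · obtain ⟨y, hy, hδ⟩ := exists_adj_of_isRightDescent h
    refine ⟨y, mem_panel_of_adj hy.symm, ?_⟩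
    rw [hδ]
    exact cs.isRightDescent_iff_not_isRightDescent_mul.1 h
  · exact ⟨x, D.mem_panel_self s x, h⟩

variable {D}

theorem δ_eq_or_of_mem_panel {s : S} {x y : C} (h : y ∈ D.panel s x) (z : C) :
    D.δ z y = D.δ z x ∨ D.δ z y = D.δ z x * cs.simple s := by
  obtain ⟨p, hp, hd⟩ := D.exists_gate z x s
  by_cases hxy : y = x
  · exact Or.inl (by rw [hxy])
  have key : ∀ q ∈ D.panel s x, q ≠ p → D.δ z q = D.δ z p * cs.simple s := fun q hq hqp =>
    δ_eq_mul_of_not_isRightDescent (adj_of_mem_panel hp hq hqp.symm) hd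
  by_cases h1 : x = p
  · subst h1
    exact Or.inr (key y h hxy)
  · by_cases h2 : y = p
    · subst h2
      rw [key x (D.mem_panel_self s x) h1]
      simp
    · exact Or.inl ((key y h h2).trans (key x (D.mem_panel_self s x) h1).symm)

/-- The distance `t * u = u * t` from `x` to `z` has a reduced gallery in either order. -/
theorem exists_square (hM : M.IsRightAngled) {t u : S} (h : M t u = 2) {x y z : C}
    (hxy : (D.graph t).Adj x y) (hyz : (D.graph u).Adj y z) :
    ∃ y', (D.graph u).Adj x y' ∧ (D.graph t).Adj y' z := by
  have h1 : D.δ x y = cs.simple t := D.δ_eq_simple_iff.2 hxy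
  have hut : M u t = 2 := M.symmetric t u ▸ h
  have hnd : ¬ cs.IsRightDescent (cs.simple t) u := by
    have := cs.isRightDescent_mul_simple_iff_of_commute hM (w := 1) h
    rw [one_mul] at this
    rw [this]
    exact cs.not_isRightDescent_one u
  have h2 : D.δ x z = cs.simple t * cs.simple u := by
    rw [δ_eq_mul_of_not_isRightDescent hyz (h1 ▸ hnd), h1]
  have h3 : cs.IsRightDescent (D.δ x z) t := by
    rw [h2, cs.isRightDescent_mul_simple_iff_of_commute hM hut]
    simp [IsRightDescent]
  obtain ⟨y', hy', hδ⟩ := exists_adj_of_isRightDescent h3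
  refine ⟨y', ?_, hy'⟩
  rw [← D.δ_eq_simple_iff, hδ, h2, cs.simple_comm h]
  simp

variable (D)

/-- The chambers `x` and `y` are joined by a gallery all of whose colours commute with `u`. -/
def CommEquiv (u : S) : C → C → Prop :=
  Relation.ReflTransGen fun x y => ∃ t, M t u = 2 ∧ (D.graph t).Adj x y

variable {D}

theorem CommEquiv.symm {u : S} {x y : C} (h : D.CommEquiv u x y) : D.CommEquiv u y x := by
  induction h with
  | refl => exact Relation.ReflTransGen.refl
  | tail _ ha ih =>
    obtain ⟨t, ht, ha⟩ := ha
    exact Relation.ReflTransGen.head ⟨t, ht, ha.symm⟩ ih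

theorem CommEquiv.trans {u : S} {x y z : C} (h : D.CommEquiv u x y) (h' : D.CommEquiv u y z) :
    D.CommEquiv u x z := Relation.ReflTransGen.trans h h'

theorem CommEquiv.of_adj {u t : S} (ht : M t u = 2) {x y : C} (h : (D.graph t).Adj x y) :
    D.CommEquiv u x y := Relation.ReflTransGen.single ⟨t, ht, h⟩

theorem CommEquiv.isRightDescent_iff (hM : M.IsRightAngled) {u : S} {x y : C}
    (h : D.CommEquiv u x y) (z : C) :
    cs.IsRightDescent (D.δ z x) u ↔ cs.IsRightDescent (D.δ z y) u := by
  induction h with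
  | refl => rfl
  | tail _ ha ih =>
    obtain ⟨t, ht, ha⟩ := ha
    rw [ih]
    rcases δ_eq_or_of_mem_panel (mem_panel_of_adj ha) z with h | h
    · rw [h]
    · rw [h, cs.isRightDescent_mul_simple_iff_of_commute hM ht]

/-- Being the gate of a `u`-panel is preserved along colours commuting with `u`. Seen from `x`, both
`x` and `y` are therefore gates of the same panel. -/
theorem CommEquiv.eq_of_mem_panel (hM : M.IsRightAngled) {u : S} {x y : C}
    (h : D.CommEquiv u x y) (hp : y ∈ D.panel u x) : x = y := by
  refine eq_of_not_isRightDescent hp (z := x) ?_ ?_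
  · rw [D.δ_self]
    exact cs.not_isRightDescent_one u
  · rw [← h.isRightDescent_iff hM, D.δ_self]
    exact cs.not_isRightDescent_one u

/-- Squares are pushed along the gallery, so the `u`-panels of a product residue are parallel. With
`CommEquiv.eq_of_mem_panel` this yields the product decomposition. -/
theorem CommEquiv.exists_of_mem_panel (hM : M.IsRightAngled) {u : S} {x y y' : C}
    (h : D.CommEquiv u x y) (hp : y' ∈ D.panel u y) :
    ∃ x' ∈ D.panel u x, D.CommEquiv u x' y' := by
  induction h generalizing y' with
  | refl => exact ⟨y', hp, Relation.ReflTransGen.refl⟩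
  | tail _ ha ih =>
    rename_i b e _
    obtain ⟨t, ht, ha⟩ := ha
    rcases D.mem_panel_iff.1 hp with rfl | hp
    · obtain ⟨x', hx', h⟩ := ih (D.mem_panel_self u b)
      exact ⟨x', hx', h.trans (CommEquiv.of_adj ht ha)⟩
    · obtain ⟨b', hb, hb'⟩ := exists_square hM ht ha hp
      obtain ⟨x', hx', h⟩ := ih (mem_panel_of_adj hb)
      exact ⟨x', hx', h.trans (CommEquiv.of_adj ht hb')⟩

end Building

/-! ### Based colourings -/

namespace Building

open ChamberSystem CoxeterSystem

variable {S W C : Type*} [Group W] {M : CoxeterMatrix S} {cs : CoxeterSystem M W}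
  (D : Building cs C)

/-- A colouring of the chambers, with one colour for each `u`, the colours for `u` being the
chambers of the `u`-panel of `c`. It is bijective on `u`-panels, does not change along galleries
whose colours commute with `u`, and takes the value `c` at the chamber of each `u`-panel closest
to `c`. -/
structure IsBasedColouring (c : C) (h : S → C → C) : Prop where
  bijOn : ∀ u x, Set.BijOn (h u) (D.panel u x) (D.panel u c)
  eq_of_commute : ∀ t u, M t u = 2 → ∀ x y, (D.graph t).Adj x y → h u x = h u y
  eq_base_iff : ∀ u x, h u x = c ↔ ¬ cs.IsRightDescent (D.δ c x) u

/-- The relation of lying in a common residue of type `u` together with all colours that commute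
with `u`. -/
def wallSetoid (hM : M.IsRightAngled) (u : S) : Setoid C where
  r x y := ∃ z ∈ D.panel u x, D.CommEquiv u z y
  iseqv :=
    { refl := fun x => ⟨x, D.mem_panel_self u x, Relation.ReflTransGen.refl⟩
      symm := by
        rintro x y ⟨z, hz, h⟩
        exact h.symm.exists_of_mem_panel hM (mem_panel_symm hz)
      trans := by
        rintro x y w ⟨z, hz, h⟩ ⟨z', hz', h'⟩
        obtain ⟨x', hx', h''⟩ := h.exists_of_mem_panel hM hz'
        exact ⟨x', mem_panel_trans hz hx', h''.trans h'⟩ }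

variable {D}

theorem wallSetoid_of_mem_panel (hM : M.IsRightAngled) {u : S} {x y : C} (h : y ∈ D.panel u x) :
    D.wallSetoid hM u x y := ⟨y, h, Relation.ReflTransGen.refl⟩

theorem wallSetoid_of_commEquiv (hM : M.IsRightAngled) {u : S} {x y : C}
    (h : D.CommEquiv u x y) : D.wallSetoid hM u x y := ⟨x, D.mem_panel_self u x, h⟩

theorem IsBasedColouring.eq_of_commEquiv {c : C} {h : S → C → C} (hh : D.IsBasedColouring c h)
    {u : S} {x y : C} (hxy : D.CommEquiv u x y) : h u x = h u y := by
  induction hxy with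
  | refl => rfl
  | tail _ ha ih =>
    obtain ⟨t, ht, ha⟩ := ha
    exact ih.trans (hh.eq_of_commute t u ht _ _ ha)

theorem IsBasedColouring.mem_panel {c : C} {h : S → C → C} (hh : D.IsBasedColouring c h)
    (u : S) (x : C) : h u x ∈ D.panel u c := (hh.bijOn u x).mapsTo (D.mem_panel_self u x)

theorem IsBasedColouring.eq_of_eq {c : C} {h : S → C → C} (hh : D.IsBasedColouring c h)
    {u : S} {x y : C} (hxy : y ∈ D.panel u x) (he : h u x = h u y) : x = y :=
  (hh.bijOn u x).injOn (D.mem_panel_self u x) hxy he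

theorem exists_panel_equiv (hreg : D.IsSemiRegular) (u : S) (c x : C) :
    ∃ e : C → C, Set.BijOn e (D.panel u x) (D.panel u c) ∧
      ∀ p ∈ D.panel u x, (e p = c ↔ ¬ cs.IsRightDescent (D.δ c p) u) := by
  classical
  obtain ⟨e⟩ := Cardinal.eq.1 (hreg u x c)
  obtain ⟨p, hp, hd⟩ := D.exists_gate c x u
  -- The transposition corrects an arbitrary bijection so that the gate `p` goes to `c`.
  let e' : D.panel u x ≃ D.panel u c :=
    e.trans (Equiv.swap (e ⟨p, hp⟩) ⟨c, D.mem_panel_self u c⟩)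
  have he' : e' ⟨p, hp⟩ = ⟨c, D.mem_panel_self u c⟩ := by simp [e']
  let f : C → C := fun y => if hy : y ∈ D.panel u x then e' ⟨y, hy⟩ else c
  have hf : ∀ y (hy : y ∈ D.panel u x), f y = e' ⟨y, hy⟩ := fun y hy => dif_pos hy
  have hinj : Set.InjOn f (D.panel u x) := by
    intro y hy z hz hyz
    rw [hf y hy, hf z hz] at hyz
    exact congrArg Subtype.val (e'.injective (Subtype.ext hyz))
  refine ⟨f, ⟨fun y hy => ?_, hinj, fun z hz => ?_⟩, fun q hq => ⟨fun h => ?_, fun h => ?_⟩⟩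
  · rw [hf y hy]
    exact (e' _).2
  · refine ⟨e'.symm ⟨z, hz⟩, (e'.symm ⟨z, hz⟩).2, ?_⟩
    rw [hf _ (e'.symm ⟨z, hz⟩).2]
    simp
  · have : q = p := hinj hq hp (by rw [h, hf p hp, he'])
    rwa [this]
  · have : q = p :=
      eq_of_not_isRightDescent (mem_panel_trans (mem_panel_symm hq) hp) h hd
    subst this
    rw [hf q hp, he']

theorem exists_isBasedColouring (hM : M.IsRightAngled) (hreg : D.IsSemiRegular) (c : C) :
    ∃ h, D.IsBasedColouring c h := by
  choose e he hec using fun u x => exists_panel_equiv hreg u c x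
  -- One `u`-panel is chosen in each product residue and coloured by `e`; every other chamber `x`
  -- takes the colour of its projection `z u x` to that panel.
  let rep : S → C → C := fun u x => (Quotient.mk (D.wallSetoid hM u) x).out
  have hrep : ∀ u x, ∃ z ∈ D.panel u (rep u x), D.CommEquiv u z x := fun u x =>
    Quotient.mk_out (s := D.wallSetoid hM u) x
  have hrep' : ∀ u x y, D.wallSetoid hM u x y → rep u x = rep u y := fun u x y hxy =>
    congrArg Quotient.out (Quotient.sound (s := D.wallSetoid hM u) hxy)
  choose z hz hzx using hrep
  have huniq : ∀ u x, ∀ p ∈ D.panel u (rep u x), D.CommEquiv u p x → p = z u x := by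
    intro u x p hp hpx
    exact (hpx.trans (hzx u x).symm).eq_of_mem_panel hM
      (mem_panel_trans (mem_panel_symm hp) (hz u x))
  refine ⟨fun u x => e u (rep u x) (z u x), ⟨fun u x => ⟨fun y hy => ?_, fun y hy y' hy' h => ?_,
    fun p hp => ?_⟩, fun t u htu x y hxy => ?_, fun u x => ?_⟩⟩
  · exact (he u _).mapsTo (hz u y)
  · have hyy' := mem_panel_trans (mem_panel_symm hy) hy'
    have h1 := hrep' u y y' (wallSetoid_of_mem_panel hM hyy')
    have h2 : z u y = z u y' := by
      refine (he u (rep u y)).injOn (hz u y) (h1 ▸ hz u y') ?_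
      simpa only [← h1] using h
    exact ((hzx u y).symm.trans (h2 ▸ hzx u y')).eq_of_mem_panel hM hyy'
  · obtain ⟨q, hq, rfl⟩ := (he u (rep u x)).surjOn hp
    obtain ⟨y, hy, hyq⟩ := (hzx u x).symm.exists_of_mem_panel hM
      (mem_panel_trans (mem_panel_symm (hz u x)) hq)
    have h1 := hrep' u x y (wallSetoid_of_mem_panel hM hy)
    refine ⟨y, hy, ?_⟩
    rw [h1] at hq
    simp only [h1, ← huniq u y q hq hyq.symm]
  · have h0 := CommEquiv.of_adj htu hxy
    have h1 := hrep' u x y (wallSetoid_of_commEquiv hM h0)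
    have h2 := huniq u y (z u x) (h1 ▸ hz u x) ((hzx u x).trans h0)
    simp only [h1, h2]
  · rw [hec u _ _ (hz u x), (hzx u x).isRightDescent_iff hM]

/-- Permuting the colours on each residue gives a new colouring. -/
theorem IsBasedColouring.comp_perm (hM : M.IsRightAngled) {c : C} {h : S → C → C}
    (hh : D.IsBasedColouring c h) (σ : S → C → Equiv.Perm C)
    (hσ : ∀ u x y, D.wallSetoid hM u x y → σ u x = σ u y)
    (hmaps : ∀ u x, ∀ y, σ u x y ∈ D.panel u c ↔ y ∈ D.panel u c) (hc : ∀ u x, σ u x c = c) :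
    D.IsBasedColouring c fun u x => σ u x (h u x) where
  bijOn u x := by
    have h1 : Set.BijOn (σ u x) (D.panel u c) (D.panel u c) :=
      ⟨fun y hy => (hmaps u x y).2 hy, (σ u x).injective.injOn, fun y hy =>
        ⟨(σ u x).symm y, (hmaps u x _).1 (by simpa using hy), by simp⟩⟩
    refine (h1.comp (hh.bijOn u x)).congr fun y hy => ?_
    rw [Function.comp_apply, hσ u x y (wallSetoid_of_mem_panel hM hy)]
  eq_of_commute t u htu x y hxy := by
    simp only [hσ u x y (wallSetoid_of_commEquiv hM (CommEquiv.of_adj htu hxy)),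
      hh.eq_of_commute t u htu x y hxy]
  eq_base_iff u x := by
    rw [← hh.eq_base_iff]
    constructor
    · intro h1
      exact (σ u x).injective (h1.trans (hc u x).symm)
    · intro h1
      rw [h1, hc]

end Building

/-! ### Automorphisms from pairs of colourings -/

namespace Building

open ChamberSystem CoxeterSystem

variable {S W C : Type*} [Group W] {M : CoxeterMatrix S} {cs : CoxeterSystem M W}
  (D : Building cs C)

/-- `x'` is reached from `c` by a geodesic gallery whose type and colours with respect to `h'` agree
with the type and the colours with respect to `h` of a geodesic gallery from `c` to `x`. -/
inductive Lift (c : C) (h h' : S → C → C) : C → C → Prop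
  | base : Lift c h h' c c
  | step {s : S} {p x p' x' : C} (hp : Lift c h h' p p') (hd : ¬ cs.IsRightDescent (D.δ c p) s)
      (hx : (D.graph s).Adj p x) (hx' : (D.graph s).Adj p' x') (he : h s x = h' s x') :
      Lift c h h' x x'

variable {D} {c : C} {h h' : S → C → C}

/-- After an `s`-step only the `s`-colour is prescribed. A colour commuting with `s` does not
change, and a colour `u` not commuting with `s` is forced to be `c`, because `u` cannot be a descent
alongside `s`. -/
theorem Lift.δ_eq_and (hM : M.IsRightAngled) (hh : D.IsBasedColouring c h)
    (hh' : D.IsBasedColouring c h') {x x' : C} (hl : D.Lift c h h' x x') :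
    D.δ c x = D.δ c x' ∧ ∀ u, h u x = h' u x' := by
  induction hl with
  | base =>
    refine ⟨rfl, fun u => ?_⟩
    have hd : ¬ cs.IsRightDescent (D.δ c c) u := by
      rw [D.δ_self]
      exact cs.not_isRightDescent_one u
    rw [(hh.eq_base_iff u c).2 hd, (hh'.eq_base_iff u c).2 hd]
  | @step s p x p' x' hp hd hx hx' he ih =>
    have h1 := δ_eq_mul_of_not_isRightDescent hx hd
    have h2 : D.δ c x = D.δ c x' := by
      rw [δ_eq_mul_of_not_isRightDescent hx' (ih.1 ▸ hd), ← ih.1, h1]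
    refine ⟨h2, fun u => ?_⟩
    by_cases hsu : s = u
    · exact hsu ▸ he
    rcases hM s u hsu with hm | hm
    · rw [← hh.eq_of_commute s u hm _ _ hx, ← hh'.eq_of_commute s u hm _ _ hx', ih.2]
    · have h3 : ¬ cs.IsRightDescent (D.δ c x) u :=
        cs.not_isRightDescent_of_infinite hM hm (h1 ▸ cs.isRightDescent_mul_simple_self hd)
      rw [(hh.eq_base_iff u x).2 h3, (hh'.eq_base_iff u x').2 (h2 ▸ h3)]

theorem Lift.symm (hM : M.IsRightAngled) (hh : D.IsBasedColouring c h)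
    (hh' : D.IsBasedColouring c h') {x x' : C} (hl : D.Lift c h h' x x') :
    D.Lift c h' h x' x := by
  induction hl with
  | base => exact Lift.base
  | step hp hd hx hx' he ih =>
    exact ih.step ((hp.δ_eq_and hM hh hh').1 ▸ hd) hx' hx he.symm

theorem Lift.exists_step (hM : M.IsRightAngled) (hh : D.IsBasedColouring c h)
    (hh' : D.IsBasedColouring c h') {s : S} {p p' x : C} (hl : D.Lift c h h' p p')
    (hd : ¬ cs.IsRightDescent (D.δ c p) s) (hx : (D.graph s).Adj p x) :
    ∃ x', (D.graph s).Adj p' x' ∧ D.Lift c h h' x x' := by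
  obtain ⟨x', hx', he⟩ := (hh'.bijOn s p').surjOn (hh.mem_panel s x)
  rcases D.mem_panel_iff.1 hx' with rfl | hx'
  -- The required colour is not already that of `p'`: that is the colour of `p`, and `h s` separates
  -- `p` from `x`.
  · exfalso
    rw [← (hl.δ_eq_and hM hh hh').2 s] at he
    exact hx.ne (hh.eq_of_eq (mem_panel_of_adj hx) he)
  · exact ⟨x', hx', hl.step hd hx hx' he.symm⟩

theorem exists_lift (hM : M.IsRightAngled) (hh : D.IsBasedColouring c h)
    (hh' : D.IsBasedColouring c h') (x : C) : ∃ x', D.Lift c h h' x x' := by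
  induction hn : cs.length (D.δ c x) using Nat.strong_induction_on generalizing x with
  | _ n ih =>
    subst hn
    by_cases h1 : D.δ c x = 1
    · obtain rfl := D.δ_eq_one_iff.1 h1
      exact ⟨c, Lift.base⟩
    · obtain ⟨s, hs⟩ := cs.exists_rightDescent_of_ne_one h1
      obtain ⟨p, hp, hδ⟩ := exists_adj_of_isRightDescent hs
      obtain ⟨p', hl⟩ := ih _ hs p (by rw [hδ])
      have hd : ¬ cs.IsRightDescent (D.δ c p) s :=
        hδ ▸ cs.isRightDescent_iff_not_isRightDescent_mul.1 hs
      obtain ⟨x', -, hx'⟩ := hl.exists_step hM hh hh' hd hp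
      exact ⟨x', hx'⟩

theorem isRightDescent_of_adj {s : S} {p x z : C} (hd : ¬ cs.IsRightDescent (D.δ z p) s)
    (hx : (D.graph s).Adj p x) : cs.IsRightDescent (D.δ z x) s :=
  δ_eq_mul_of_not_isRightDescent hx hd ▸ cs.isRightDescent_mul_simple_self hd

theorem Lift.unique (hM : M.IsRightAngled) (hh : D.IsBasedColouring c h)
    (hh' : D.IsBasedColouring c h') {x x₁ x₂ : C} (h₁ : D.Lift c h h' x x₁)
    (h₂ : D.Lift c h h' x x₂) : x₁ = x₂ := by
  induction hn : cs.length (D.δ c x) using Nat.strong_induction_on generalizing x x₁ x₂ with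
  | _ n ih =>
    subst hn
    cases h₁ with
    | base =>
      cases h₂ with
      | base => rfl
      | step _ hd hx _ _ =>
        have := isRightDescent_of_adj hd hx
        rw [D.δ_self] at this
        exact absurd this (cs.not_isRightDescent_one _)
    | @step s p _ p' _ hp hd hx hx' he =>
      have hs := isRightDescent_of_adj hd hx
      cases h₂ with
      | base =>
        rw [D.δ_self] at hs
        exact absurd hs (cs.not_isRightDescent_one _)
      | @step t q _ q' _ hq hd₂ hx₂ hx₂' he₂ =>
        have ht := isRightDescent_of_adj hd₂ hx₂
        have hδp := δ_eq_mul_of_not_isRightDescent hx hd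
        have hδq := δ_eq_mul_of_not_isRightDescent hx₂ hd₂
        have hlt : ∀ {s : S} {w v : W}, cs.IsRightDescent w s → w = v * cs.simple s →
            cs.length v < cs.length w := by
          rintro s w v hs rfl
          simpa [IsRightDescent] using hs
        have hltp := hlt hs hδp
        have hltq := hlt ht hδq
        by_cases hst : s = t
        · subst hst
          obtain rfl : p = q := eq_of_not_isRightDescent
            (mem_panel_trans (mem_panel_of_adj hx) (mem_panel_of_adj hx₂.symm)) hd hd₂
          obtain rfl := ih _ hltp hp hq rfl
          exact hh'.eq_of_eq
            (mem_panel_trans (mem_panel_of_adj hx'.symm) (mem_panel_of_adj hx₂')) (he ▸ he₂)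
        · have hm := cs.commute_of_isRightDescent hM hst hs ht
          have hm' : M t s = 2 := M.symmetric s t ▸ hm
          have htp : cs.IsRightDescent (D.δ c p) t := by
            rwa [hδp, cs.isRightDescent_mul_simple_iff_of_commute hM hm] at ht
          -- The last letters `s` and `t` commute, so `p`, `x`, `q` complete to a square whose
          -- chamber `r` is nearest to `c`. A lift of `r` extends to both `p'` and `q'` by
          -- induction, and the fourth corner `y` above them has the `s`- and `t`-colours of `x`,
          -- hence equals both candidates.
          obtain ⟨r, hr, hδr⟩ := exists_adj_of_isRightDescent htp
          have hrt : ¬ cs.IsRightDescent (D.δ c r) t :=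
            hδr ▸ cs.isRightDescent_iff_not_isRightDescent_mul.1 htp
          have hrs : ¬ cs.IsRightDescent (D.δ c r) s := by
            rwa [hδr, cs.isRightDescent_mul_simple_iff_of_commute hM hm']
          obtain ⟨q₀, hrq, hqx⟩ := exists_square hM hm' hr hx
          have hq₀ : ¬ cs.IsRightDescent (D.δ c q₀) t := by
            rwa [δ_eq_mul_of_not_isRightDescent hrq hrs,
              cs.isRightDescent_mul_simple_iff_of_commute hM hm]
          obtain rfl : q₀ = q := eq_of_not_isRightDescent
            (mem_panel_trans (mem_panel_of_adj hqx) (mem_panel_of_adj hx₂.symm)) hq₀ hd₂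
          obtain ⟨r', hr'⟩ := exists_lift hM hh hh' r
          obtain ⟨p'', hrp', hlp⟩ := hr'.exists_step hM hh hh' hrt hr
          obtain ⟨q'', hrq', hlq⟩ := hr'.exists_step hM hh hh' hrs hrq
          obtain rfl := ih _ hltp hp hlp rfl
          obtain rfl := ih _ hltq hq hlq rfl
          obtain ⟨y, hpy, hyq⟩ := exists_square hM hm' hrp'.symm hrq'
          have e1 : h' s y = h s x := by
            rw [hh'.eq_of_commute t s hm' _ _ hyq, ← (hq.δ_eq_and hM hh hh').2,
              hh.eq_of_commute t s hm' _ _ hx₂]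
          have e2 : h' t y = h t x := by
            rw [← hh'.eq_of_commute s t hm _ _ hpy, ← (hp.δ_eq_and hM hh hh').2,
              hh.eq_of_commute s t hm _ _ hx]
          have y1 : y = x₁ := hh'.eq_of_eq
            (mem_panel_trans (mem_panel_of_adj hpy.symm) (mem_panel_of_adj hx')) (e1.trans he)
          have y2 : y = x₂ := hh'.eq_of_eq
            (mem_panel_trans (mem_panel_of_adj hyq) (mem_panel_of_adj hx₂')) (e2.trans he₂)
          exact y1.symm.trans y2

/-- Two colourings with the same base chamber differ by a type-preserving automorphism. -/
theorem exists_autGroup_of_isBasedColouring (hM : M.IsRightAngled)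
    (hh : D.IsBasedColouring c h) (hh' : D.IsBasedColouring c h') :
    ∃ g ∈ D.autGroup, ∀ x, D.Lift c h h' x (g x) := by
  choose g hg using exists_lift hM hh hh'
  choose g' hg' using exists_lift hM hh' hh
  have hadj : ∀ {h h' : S → C → C}, D.IsBasedColouring c h → D.IsBasedColouring c h' →
      ∀ g : C → C, (∀ x, D.Lift c h h' x (g x)) → Function.Injective g →
      ∀ s x y, (D.graph s).Adj x y → (D.graph s).Adj (g x) (g y) := by
    intro h h' hh hh' g hg hinj s x y hxy
    obtain ⟨p, hp, hd⟩ := D.exists_gate c x s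
    -- Every chamber of the panel other than the gate `p` is lifted through `p`, so the images all
    -- lie in the panel of `g p`.
    have key : ∀ z ∈ D.panel s x, g z ∈ D.panel s (g p) := by
      intro z hz
      rcases D.mem_panel_iff.1 (mem_panel_trans (mem_panel_symm hp) hz) with rfl | hz
      · exact D.mem_panel_self s _
      · obtain ⟨z', hz', hl⟩ := (hg p).exists_step hM hh hh' hd hz
        rw [(hg z).unique hM hh hh' hl]
        exact mem_panel_of_adj hz'
    exact adj_of_mem_panel (key x (D.mem_panel_self s x)) (key y (mem_panel_of_adj hxy))
      fun he => hxy.ne (hinj he)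
  have hleft : Function.LeftInverse g' g := fun x =>
    (hg' (g x)).unique hM hh' hh ((hg x).symm hM hh hh')
  have hright : Function.RightInverse g' g := fun x =>
    (hg (g' x)).unique hM hh hh' ((hg' x).symm hM hh' hh)
  refine ⟨⟨g, g', hleft, hright⟩, fun s x y => ⟨fun hxy => ?_, ?_⟩, hg⟩
  · have := hadj hh' hh g' hg' hright.injective s _ _ hxy
    simpa [hleft x, hleft y] using this
  · exact hadj hh hh' g hg hleft.injective s x y

end Building

/-! ### Roots and wings in terms of left descents -/

namespace CoxeterSystem

variable {S W : Type*} [Group W] {M : CoxeterMatrix S} (cs : CoxeterSystem M W)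

theorem not_isLeftDescent_iff_parity (hM : M.IsRightAngled) {w : W} {s : S} :
    ¬ cs.IsLeftDescent w s ↔ cs.parity hM w⁻¹ (cs.simple s) = 0 := by
  rw [← cs.isRightDescent_inv_iff, cs.isRightDescent_iff_parity hM]
  rcases zmod_two_eq_zero_or_one (cs.parity hM w⁻¹ (cs.simple s)) with h | h <;> simp [h]

theorem not_isLeftDescent_of_mul {w : W} {s t : S} (ht : ¬ cs.IsRightDescent w t)
    (h : ¬ cs.IsLeftDescent (w * cs.simple t) s) : ¬ cs.IsLeftDescent w s := by
  intro hs
  apply h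
  have h1 := cs.not_isRightDescent_iff.1 ht
  have h2 := cs.isLeftDescent_iff.1 hs
  have h3 := cs.length_mul_le (cs.simple s * w) (cs.simple t)
  rw [cs.length_simple, mul_assoc] at h3
  unfold IsLeftDescent
  omega

/-- Appending `t` changes the side of the wall of `s`, so the edge from `w` to `w * t` lies on that
wall, that is, `w * t * w⁻¹ = s`. -/
theorem simple_mul_eq_mul_simple (hM : M.IsRightAngled) {w : W} {s t : S}
    (h : ¬ cs.IsLeftDescent w s) (h' : cs.IsLeftDescent (w * cs.simple t) s) :
    cs.simple s * w = w * cs.simple t := by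
  classical
  have h1 := (cs.not_isLeftDescent_iff_parity hM).1 h
  have h2 := mt (cs.not_isLeftDescent_iff_parity hM).2 (not_not.2 h')
  rw [mul_inv_rev, parity_mul, h1, zero_add, cs.inv_simple, parity_simple, inv_inv] at h2
  have h3 : w⁻¹ * cs.simple s * w = cs.simple t := by
    by_contra h3
    exact h2 (if_neg h3)
  rw [← h3]
  group

/-- If `w` lies in a root and `w * s` does not, then the translate of the root by `w⁻¹` consists of
the elements without left descent `s`. -/
theorem mul_mem_thinRoot_iff (hM : M.IsRightAngled) {β : Set W} (hβ : Building.IsThinRoot cs β)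
    {w : W} {s : S} (hw : w ∈ β) (hws : w * cs.simple s ∉ β) (v : W) :
    w * v ∈ β ↔ ¬ cs.IsLeftDescent v s := by
  classical
  obtain ⟨r, x, y, hxy, rfl⟩ := hβ
  have hy : y = x * cs.simple r := by
    rw [← (show x⁻¹ * y = cs.simple r from hxy)]
    group
  have hz : ∀ a b : ZMod 2, a + b ≠ 1 ↔ b = a := by decide
  -- The root is the set of elements on the same side as `x` of the wall of the reflection `x * r *
  -- x⁻¹`.
  have key : ∀ v, v ∈ {w | (thinBuilding cs).dist w x < (thinBuilding cs).dist w y} ↔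
      cs.parity hM v⁻¹ (x * cs.simple r * x⁻¹) = cs.parity hM x (cs.simple r) := by
    intro v
    change cs.length (v⁻¹ * x) < cs.length (v⁻¹ * y) ↔ _
    rw [hy, ← mul_assoc, ← hz, ← parity_mul, ne_eq, ← cs.isRightDescent_iff_parity hM,
      IsRightDescent, not_lt]
    exact ⟨le_of_lt, fun h => lt_of_le_of_ne h (cs.length_mul_simple_ne _ _).symm⟩
  rw [key] at hw hws
  -- The edge from `w` to `w * s` crosses the wall, so its reflection `w * s * w⁻¹` is the one
  -- defining the root.
  have hρ : w⁻¹ * (x * cs.simple r * x⁻¹) * w = cs.simple s := by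
    by_contra hne
    apply hws
    rw [mul_inv_rev, parity_mul, hw, cs.inv_simple, parity_simple, inv_inv, if_neg hne, add_zero]
  rw [key, mul_inv_rev, parity_mul, hw, inv_inv, hρ, cs.not_isLeftDescent_iff_parity hM]
  exact ⟨fun h => by simpa using h, fun h => by rw [h, add_zero]⟩

/-- The subgroup generated by the generators that commute with `u`. -/
def commSubgroup (u : S) : Subgroup W := Subgroup.closure (cs.simple '' {t | M t u = 2})

theorem simple_mem_commSubgroup {t u : S} (h : M t u = 2) : cs.simple t ∈ cs.commSubgroup u :=
  Subgroup.subset_closure ⟨t, h, rfl⟩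

end CoxeterSystem

/-! ### Recolouring two apartments that share a root -/

namespace Building

open ChamberSystem CoxeterSystem

variable {S W C : Type*} [Group W] {M : CoxeterMatrix S} {cs : CoxeterSystem M W}
  {D : Building cs C}

theorem mem_wing_iff {s : S} {c x : C} : x ∈ D.wing s c ↔ ¬ cs.IsLeftDescent (D.δ c x) s := by
  rw [← cs.isRightDescent_inv_iff, D.δ_inv]
  constructor
  · rintro ⟨-, h⟩ hd
    obtain ⟨y, hy, hδ⟩ := exists_adj_of_isRightDescent hd
    have h1 := h y (mem_panel_of_adj hy.symm) hy.ne
    rw [dist, dist, hδ] at h1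
    exact lt_asymm hd h1
  · intro hd
    refine ⟨D.mem_panel_self s c, fun q hq hqc => ?_⟩
    rw [dist, dist, δ_eq_mul_of_not_isRightDescent
      (adj_of_mem_panel (D.mem_panel_self s c) hq hqc.symm) hd, cs.not_isRightDescent_iff.1 hd]
    exact Nat.lt_succ_self _

theorem CommEquiv.exists_δ_eq {u : S} {x y : C} (h : D.CommEquiv u x y) (z : C) :
    ∃ b ∈ cs.commSubgroup u, D.δ z y = D.δ z x * b := by
  induction h with
  | refl => exact ⟨1, Subgroup.one_mem _, (mul_one _).symm⟩
  | tail _ ha ih =>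
    obtain ⟨t, ht, ha⟩ := ha
    obtain ⟨b, hb, h⟩ := ih
    rcases δ_eq_or_of_mem_panel (mem_panel_of_adj ha) z with h1 | h1
    · exact ⟨b, hb, h1.trans h⟩
    · exact ⟨b * cs.simple t, Subgroup.mul_mem _ hb (cs.simple_mem_commSubgroup ht),
        by rw [h1, h, mul_assoc]⟩

theorem IsThinIsometry.δ_eq {f : W → C} (hf : D.IsThinIsometry f) (v w : W) :
    D.δ (f v) (f w) = v⁻¹ * w := hf v w

theorem IsThinIsometry.adj {f : W → C} (hf : D.IsThinIsometry f) (w : W) (s : S) :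
    (D.graph s).Adj (f w) (f (w * cs.simple s)) := by
  rw [← D.δ_eq_simple_iff, hf.δ_eq]
  group

theorem IsThinIsometry.comp_mul_left {f : W → C} (hf : D.IsThinIsometry f) (w : W) :
    D.IsThinIsometry fun v => f (w * v) := by
  intro x y
  rw [hf.δ_eq]
  change _ = x⁻¹ * y
  group

theorem IsThinIsometry.commEquiv {f : W → C} (hf : D.IsThinIsometry f) {u : S} (w : W) {b : W}
    (hb : b ∈ cs.commSubgroup u) : D.CommEquiv u (f w) (f (w * b)) := by
  induction hb using Subgroup.closure_induction generalizing w with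
  | mem x hx =>
    obtain ⟨t, ht, rfl⟩ := hx
    exact CommEquiv.of_adj ht (hf.adj w t)
  | one =>
    rw [mul_one]
    exact Relation.ReflTransGen.refl
  | mul x y _ _ hx hy =>
    rw [← mul_assoc]
    exact (hx w).trans (hy _)
  | inv x _ hx => simpa using (hx (w * x⁻¹)).symm

/-- A gallery of colours commuting with `u` that leaves a set has an edge leaving that set. -/
theorem CommEquiv.exists_crossing {u : S} {x y : C} (h : D.CommEquiv u x y) {P : Set C}
    (hx : x ∈ P) (hy : y ∉ P) :
    ∃ a b t, a ∈ P ∧ b ∉ P ∧ M t u = 2 ∧ (D.graph t).Adj a b ∧ D.CommEquiv u a y := by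
  induction h using Relation.ReflTransGen.head_induction_on with
  | refl => exact absurd hx hy
  | head hab hby ih =>
    rename_i a b
    by_cases hb : b ∈ P
    · exact ih hb
    · obtain ⟨t, ht, ha⟩ := hab
      exact ⟨a, b, t, hx, hb, ht, ha, Relation.ReflTransGen.head ⟨t, ht, ha⟩ hby⟩

theorem simple_mul_δ_of_crossing (hM : M.IsRightAngled) {s t : S} {a b c : C}
    (ha : a ∈ D.wing s c) (hb : b ∉ D.wing s c) (hab : (D.graph t).Adj a b) :
    cs.simple s * D.δ c a = D.δ c a * cs.simple t := by
  rw [mem_wing_iff] at ha hb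
  rcases δ_eq_or_of_mem_panel (mem_panel_of_adj hab) c with h | h
  · exact absurd (h ▸ ha) hb
  · exact cs.simple_mul_eq_mul_simple hM ha (h ▸ not_not.1 hb)

variable {c : C} {h : S → C → C} {f f' : W → C} {s : S}

/-- If a chamber `y` of the wing and a chamber `f' m` of an apartment lie in a common residue of
type `u` together with the colours commuting with `u`, then `y` has the base colour or the
corresponding chambers `f m` and `f' m` of the two apartments have the same colour. -/
theorem colour_eq_of_wing (hM : M.IsRightAngled) (hh : D.IsBasedColouring c h)
    (hf : D.IsThinIsometry f) (hf' : D.IsThinIsometry f') (hfc' : f' 1 = c)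
    (hff' : ∀ v, ¬ cs.IsLeftDescent v s → f v = f' v) {u : S} {y : C} {m : W}
    (hy : y ∈ D.wing s c) (hym : D.wallSetoid hM u y (f' m)) :
    h u y = c ∨ h u (f m) = h u (f' m) := by
  have hδ : ∀ w, D.δ c (f' w) = w := fun w => by rw [← hfc', hf'.δ_eq, inv_one, one_mul]
  have hwing : ∀ w, f' w ∈ D.wing s c → f w = f' w := fun w hw =>
    hff' w (by rwa [mem_wing_iff, hδ] at hw)
  by_cases hm : f' m ∈ D.wing s c
  · exact Or.inr (by rw [hwing m hm])
  obtain ⟨z, hz, hzm⟩ := hym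
  by_cases hzw : z ∈ D.wing s c
  · right
    -- The gallery leaves the wing by a colour `t` commuting with `u`. Hence `s * m` is `m` times an
    -- element of `commSubgroup u`; the apartments agree at `s * m`, and inside each of them the
    -- `u`-colour at `m` is the one at `s * m`.
    obtain ⟨a, b, t, ha, hb, ht, hab, ham⟩ := hzm.exists_crossing hzw hm
    have hcross := simple_mul_δ_of_crossing hM ha hb hab
    obtain ⟨e, he, hme⟩ := ham.exists_δ_eq c
    rw [hδ] at hme
    have hsm : cs.simple s * m = m * (e⁻¹ * cs.simple t * e) := by
      rw [hme, ← mul_assoc, hcross]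
      group
    have hmem : e⁻¹ * cs.simple t * e ∈ cs.commSubgroup u :=
      Subgroup.mul_mem _ (Subgroup.mul_mem _ (Subgroup.inv_mem _ he)
        (cs.simple_mem_commSubgroup ht)) he
    have hsw : f' (m * (e⁻¹ * cs.simple t * e)) ∈ D.wing s c := by
      rw [mem_wing_iff, hδ] at hm ⊢
      rw [← hsm]
      exact cs.isLeftDescent_iff_not_isLeftDescent_mul.1 (not_not.1 hm)
    rw [hh.eq_of_commEquiv (hf.commEquiv m hmem), hh.eq_of_commEquiv (hf'.commEquiv m hmem),
      hwing _ hsw]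
  · left
    rw [hh.eq_base_iff]
    have hyz : (D.graph u).Adj y z := adj_of_mem_panel (D.mem_panel_self u y) hz (by
      rintro rfl
      exact hzw hy)
    -- Here the `u`-step itself leaves the wing, so `δ c y * u = s * δ c y`. This is longer than `δ
    -- c y` because `y` is in the wing, so `y` is the gate of its `u`-panel.
    have hcross := simple_mul_δ_of_crossing hM hy hzw hyz
    rw [mem_wing_iff] at hy
    rw [IsRightDescent, ← hcross]
    exact hy

/-- Positions of an apartment that lie in one product residue and are not gates differ by a right
factor in `commSubgroup u`, so each residue prescribes only one pair of colours to be matched. -/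
theorem colour_eq_of_wallSetoid (hM : M.IsRightAngled) (hh : D.IsBasedColouring c h)
    (hf : D.IsThinIsometry f) (hf' : D.IsThinIsometry f') (hfc' : f' 1 = c) {u : S} {m m' : W}
    (hm : cs.IsRightDescent m u) (hm' : cs.IsRightDescent m' u)
    (hmm' : D.wallSetoid hM u (f' m) (f' m')) :
    h u (f m') = h u (f m) ∧ h u (f' m') = h u (f' m) := by
  have hδ : ∀ w, D.δ c (f' w) = w := fun w => by rw [← hfc', hf'.δ_eq, inv_one, one_mul]
  obtain ⟨z, hz, hzm⟩ := hmm'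
  have h1 : D.δ c z = m := by
    have h2 := hzm.isRightDescent_iff hM c
    rw [hδ] at h2
    rcases δ_eq_or_of_mem_panel hz c with h3 | h3
    · rwa [hδ] at h3
    · rw [hδ] at h3
      rw [h3] at h2
      exact absurd (h2.2 hm') (cs.isRightDescent_iff_not_isRightDescent_mul.1 hm)
  obtain ⟨b, hb, hmb⟩ := hzm.exists_δ_eq c
  rw [hδ, h1] at hmb
  subst hmb
  exact ⟨(hh.eq_of_commEquiv (hf.commEquiv m hb)).symm,
    (hh.eq_of_commEquiv (hf'.commEquiv m hb)).symm⟩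

theorem exists_colour_perm (hM : M.IsRightAngled) (hh : D.IsBasedColouring c h)
    (hf : D.IsThinIsometry f) (hf' : D.IsThinIsometry f') (hfc : f 1 = c) (hfc' : f' 1 = c)
    (hff' : ∀ v, ¬ cs.IsLeftDescent v s → f v = f' v) (u : S) (x : C) :
    ∃ σ : Equiv.Perm C, (∀ y, σ y ∈ D.panel u c ↔ y ∈ D.panel u c) ∧ σ c = c ∧
      (∀ m, D.wallSetoid hM u (f' m) x → σ (h u (f' m)) = h u (f m)) ∧
      ∀ y ∈ D.wing s c, D.wallSetoid hM u y x → σ (h u y) = h u y := by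
  classical
  have hδ : ∀ w, D.δ c (f w) = w := fun w => by rw [← hfc, hf.δ_eq, inv_one, one_mul]
  have hδ' : ∀ w, D.δ c (f' w) = w := fun w => by rw [← hfc', hf'.δ_eq, inv_one, one_mul]
  have hbase : ∀ m, ¬ cs.IsRightDescent m u → h u (f m) = c ∧ h u (f' m) = c := fun m hm =>
    ⟨(hh.eq_base_iff u _).2 (by rwa [hδ]), (hh.eq_base_iff u _).2 (by rwa [hδ'])⟩
  -- Gates have colour `c` in both apartments, so only a non-gate position `m` imposes a condition;
  -- the transposition of its two colours, neither of which is `c`, meets it.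
  by_cases hex : ∃ m, cs.IsRightDescent m u ∧ D.wallSetoid hM u (f' m) x
  · obtain ⟨m, hm, hmx⟩ := hex
    have hne : h u (f m) ≠ c := fun hc => (hh.eq_base_iff u _).1 hc (by rwa [hδ])
    have hne' : h u (f' m) ≠ c := fun hc => (hh.eq_base_iff u _).1 hc (by rwa [hδ'])
    have hc : Equiv.swap (h u (f' m)) (h u (f m)) c = c :=
      Equiv.swap_apply_of_ne_of_ne hne'.symm hne.symm
    refine ⟨Equiv.swap (h u (f' m)) (h u (f m)), fun y => ?_, hc, fun m' hm'x => ?_,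
      fun y hy hyx => ?_⟩
    · have h1 := hh.mem_panel u (f m)
      have h2 := hh.mem_panel u (f' m)
      by_cases hy1 : y = h u (f' m)
      · rw [hy1, Equiv.swap_apply_left]
        exact iff_of_true h1 h2
      by_cases hy2 : y = h u (f m)
      · rw [hy2, Equiv.swap_apply_right]
        exact iff_of_true h2 h1
      rw [Equiv.swap_apply_of_ne_of_ne hy1 hy2]
    · by_cases hm' : cs.IsRightDescent m' u
      · obtain ⟨h1, h2⟩ := colour_eq_of_wallSetoid hM hh hf hf' hfc' hm hm'
          ((D.wallSetoid hM u).trans hmx ((D.wallSetoid hM u).symm hm'x))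
        rw [h1, h2, Equiv.swap_apply_left]
      · rw [(hbase m' hm').1, (hbase m' hm').2, hc]
    · rcases colour_eq_of_wing hM hh hf hf' hfc' hff' hy
        ((D.wallSetoid hM u).trans hyx ((D.wallSetoid hM u).symm hmx)) with h1 | h1
      · rw [h1, hc]
      · rw [h1, Equiv.swap_self, Equiv.refl_apply]
  · refine ⟨1, fun y => Iff.rfl, rfl, fun m hmx => ?_, fun y _ _ => rfl⟩
    have hm : ¬ cs.IsRightDescent m u := fun hm => hex ⟨m, hm, hmx⟩
    rw [(hbase m hm).1, (hbase m hm).2]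
    rfl

/-- The wing is closed under initial pieces of geodesics from `c`, so a geodesic to `x` stays where
the colourings coincide and is its own copy. -/
theorem Lift.wing {h' : S → C → C} (hwing : ∀ u, ∀ x ∈ D.wing s c, h' u x = h u x) {x : C}
    (hx : x ∈ D.wing s c) : D.Lift c h h' x x := by
  induction hn : cs.length (D.δ c x) using Nat.strong_induction_on generalizing x with
  | _ n ih =>
    subst hn
    by_cases h1 : D.δ c x = 1
    · obtain rfl := D.δ_eq_one_iff.1 h1
      exact Lift.base
    · obtain ⟨t, ht⟩ := cs.exists_rightDescent_of_ne_one h1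
      obtain ⟨p, hp, hδ⟩ := exists_adj_of_isRightDescent ht
      have hd : ¬ cs.IsRightDescent (D.δ c p) t :=
        hδ ▸ cs.isRightDescent_iff_not_isRightDescent_mul.1 ht
      have hpw : p ∈ D.wing s c := by
        rw [mem_wing_iff] at hx ⊢
        refine cs.not_isLeftDescent_of_mul hd ?_
        rwa [hδ, cs.simple_mul_simple_cancel_right]
      exact (ih _ ht hpw (by rw [hδ])).step hd hp hp (hwing t x hx).symm

theorem Lift.apartment {h' : S → C → C} (hf : D.IsThinIsometry f) (hf' : D.IsThinIsometry f')
    (hfc : f 1 = c) (hfc' : f' 1 = c) (hff' : ∀ u w, h' u (f' w) = h u (f w)) (w : W) :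
    D.Lift c h h' (f w) (f' w) := by
  induction hn : cs.length w using Nat.strong_induction_on generalizing w with
  | _ n ih =>
    subst hn
    by_cases h1 : w = 1
    · rw [h1, hfc, hfc']
      exact Lift.base
    · obtain ⟨t, ht⟩ := cs.exists_rightDescent_of_ne_one h1
      have hl := ih _ ht (w * cs.simple t) rfl
      have hd : ¬ cs.IsRightDescent (D.δ c (f (w * cs.simple t))) t := by
        rw [← hfc, hf.δ_eq, inv_one, one_mul]
        exact cs.isRightDescent_iff_not_isRightDescent_mul.1 ht
      have h2 := hf.adj (w * cs.simple t) t
      have h3 := hf'.adj (w * cs.simple t) t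
      rw [cs.simple_mul_simple_cancel_right] at h2 h3
      exact hl.step hd h2 h3 (hff' t w).symm

/-- Two apartments through `c` that agree on the root of chambers in the wing of `c` are conjugate
under the fixator of the wing. -/
theorem exists_autGroup_of_isThinIsometry (hM : M.IsRightAngled) (hreg : D.IsSemiRegular)
    (hf : D.IsThinIsometry f) (hf' : D.IsThinIsometry f') (hfc : f 1 = c) (hfc' : f' 1 = c)
    (hff' : ∀ v, ¬ cs.IsLeftDescent v s → f v = f' v) :
    ∃ g ∈ D.autGroup, (∀ x ∈ D.wing s c, g x = x) ∧ ∀ w, g (f w) = f' w := by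
  obtain ⟨h, hh⟩ := exists_isBasedColouring hM hreg c
  choose σ hσ₁ hσ₂ hσ₃ hσ₄ using exists_colour_perm hM hh hf hf' hfc hfc' hff'
  let rep : S → C → C := fun u x => (Quotient.mk (D.wallSetoid hM u) x).out
  have hrep : ∀ u x, D.wallSetoid hM u x (rep u x) := fun u x =>
    (D.wallSetoid hM u).symm (Quotient.mk_out (s := D.wallSetoid hM u) x)
  -- Evaluating `σ` at a representative makes the permutation constant on each product residue.
  have hh' := hh.comp_perm hM (fun u x => σ u (rep u x))
    (fun u x y hxy => congrArg (fun q => σ u (Quotient.out q))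
      (Quotient.sound (s := D.wallSetoid hM u) hxy))
    (fun u x => hσ₁ u _) (fun u x => hσ₂ u _)
  obtain ⟨g, hg, hl⟩ := exists_autGroup_of_isBasedColouring hM hh hh'
  refine ⟨g, hg, fun x hx => ?_, fun w => ?_⟩
  · exact (hl x).unique hM hh hh' (Lift.wing (fun u x hx => hσ₄ u _ x hx (hrep u x)) hx)
  · exact (hl _).unique hM hh hh'
      (Lift.apartment hf hf' hfc hfc' (fun u w => hσ₃ u _ w (hrep u _)) w)

end Building

/-! ### The root wing group acts transitively -/

theorem mainTheorem5 {S W C : Type*} [Finite S] [Group W] {M : CoxeterMatrix S}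
    (hM : M.IsRightAngled) (cs : CoxeterSystem M W) (D : Building cs C)
    (hthick : D.IsThick) (hreg : D.IsSemiRegular)
    (A α : Set C) (hα : D.IsRootOf A α)
    (s : S) (c : C) (hc : c ∈ α) (hwall : D.panel s c ∈ D.wall A α) :
    (∀ g ∈ D.wingGroup s c, ∀ B : Set C, D.IsApartment B → α ⊆ B →
      D.IsApartment (g • B) ∧ α ⊆ g • B) ∧
    (∀ B B' : Set C, D.IsApartment B → α ⊆ B → D.IsApartment B' → α ⊆ B' →
      ∃ g ∈ D.wingGroup s c, g • B = B') := by
  obtain ⟨f₀, hf₀, rfl, β, hβ, rfl⟩ := hα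
  obtain ⟨w, hw, rfl⟩ := hc
  obtain ⟨-, -, q, hq, ⟨w', rfl⟩, hw'⟩ := hwall
  have hw'β : w' ∉ β := fun h => hw' ⟨w', h, rfl⟩
  have hw's : w' = w * cs.simple s := by
    have hadj := ChamberSystem.adj_of_mem_panel (D.mem_panel_self s _) hq (by
      intro h
      exact hw' (h ▸ ⟨w, hw, rfl⟩))
    rw [← D.δ_eq_simple_iff, hf₀.δ_eq] at hadj
    rw [← hadj]
    group
  have hroot := cs.mul_mem_thinRoot_iff hM hβ hw (hw's ▸ hw'β)
  have hαwing : f₀ '' β ⊆ D.wing s (f₀ w) := by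
    rintro _ ⟨v, hv, rfl⟩
    rw [Building.mem_wing_iff, hf₀.δ_eq, ← hroot]
    simpa using hv
  have hfix : ∀ g ∈ D.wingGroup s (f₀ w), ∀ x ∈ D.wing s (f₀ w), g • x = x := fun g hg x hx =>
    (mem_fixingSubgroup_iff _).1 hg x hx
  refine ⟨fun g hg B hB hαB => ⟨?_, fun x hx => ?_⟩, fun B B' hB hαB hB' hαB' => ?_⟩
  · obtain ⟨f, hf, rfl⟩ := hB
    refine ⟨fun v => g • f v, fun x y => ?_, ?_⟩
    · exact (Building.δ_map g.2 _ _).trans (hf x y)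
    · exact Set.range_comp (fun x => g • x) f
  · exact ⟨x, hαB hx, hfix g hg x (hαwing hx)⟩
  -- Each apartment is reparametrised by left translation so that `1` goes to the given chamber. A
  -- chamber of the root is then located by its distance from that chamber, which makes the
  -- parametrisation there independent of the apartment.
  · have hparam : ∀ B : Set C, D.IsApartment B → f₀ '' β ⊆ B → ∃ f : W → C,
        D.IsThinIsometry f ∧ Set.range f = B ∧ f 1 = f₀ w ∧
          ∀ v, ¬ cs.IsLeftDescent v s → f v = f₀ (w * v) := by
      rintro _ ⟨f, hf, rfl⟩ hB
      obtain ⟨b, hb⟩ := hB ⟨w, hw, rfl⟩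
      refine ⟨fun v => f (b * v), hf.comp_mul_left b,
        (Equiv.mulLeft b).surjective.range_comp f, by simpa using hb, fun v hv => ?_⟩
      obtain ⟨b', hb'⟩ := hB ⟨w * v, (hroot v).2 hv, rfl⟩
      have h1 := hf.δ_eq b b'
      rw [hb, hb', hf₀.δ_eq, inv_mul_cancel_left] at h1
      change f (b * v) = _
      rw [← hb', h1, mul_inv_cancel_left]
    obtain ⟨f, hf, rfl, hfc, hfβ⟩ := hparam B hB hαB
    obtain ⟨f', hf', rfl, hfc', hfβ'⟩ := hparam B' hB' hαB'
    obtain ⟨g, hg, hgw, hgf⟩ := Building.exists_autGroup_of_isThinIsometry hM hreg hf hf' hfc hfc'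
      fun v hv => (hfβ v hv).trans (hfβ' v hv).symm
    refine ⟨⟨g, hg⟩, (mem_fixingSubgroup_iff _).2 hgw, ?_⟩
    calc _ = Set.range fun v => g (f v) := (Set.range_comp g f).symm
      _ = _ := by simp only [hgf]
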